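/- Let $\mathfrak g=V_1\oplus V_2$ be a finite-dimensional real Lie algebra with $[V_1,V_1]=V_2\neq\{0\}$ and $[V_1,V_2]=[V_2,V_2]=\{0\}$, equipped with an inner product for which $V_1\perp V_2$, and let $\mathbb G$ be the corresponding two step stratified group, i.e. the connected, simply connected Lie group with Lie algebra $\mathfrak g$, realized in exponential coordinates: $\exp:\mathfrak g\to\mathbb G$ is an analytic diffeomorphism with $\exp(X)\exp(Y)=\exp\big(X+Y+\tfrac12[X,Y]\big)$. Let $\delta_r(\exp(v_1+v_2))=\exp(rv_1+r^2v_2)$ for $r>0$, $v_i\in V_i$, denote the dilations, and $l_y(z)=yz$ the left translations. A homogeneous distance is a continuous distance $\rho$ on $\mathbb G$ with $\rho(ux,uy)=\rho(x,y)$ and $\rho(\delta_rx,\delta_ry)=r\rho(x,y)$ for all $u,x,y\in\mathbb G$ and $r>0$; write $D_R=\{y:\rho(e,y)\le R\}$, where $e$ is the unit element. Let $\Sigma\subset\mathbb G$ be a $p$-dimensional (embedded) $C^2$ submanifold, that is, locally around each of its points $\Sigma$ is the zero set of a $C^2$ map into $\mathbb R^{k}$, $k=\dim\mathbb G-p$,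 with surjective differential at the points of $\Sigma$. Then for every $x\in\Sigma$ there is a set $\mathcal A\subset\mathbb G$ such that: 1. for every homogeneous distance $\rho$ and every $R>0$, the sets $\big(\delta_{1/r}\,l_{x^{-1}}\Sigma\big)\cap D_R$ converge to $\mathcal A\cap D_R$, as $r\to0^+$, with respect to the Hausdorff distance of sets induced by $\rho$; 2. $\mathcal A$ is a homogeneous algebraic variety: it is the zero set of a map $P:\mathbb G\to\mathbb R^{n}$, $n\ge1$, such that $P\circ\exp$ is polynomial, and $\delta_r\mathcal A\subset\mathcal A$ for every $r>0$; 3. $\mathcal A$ is the graph of a homogeneous polynomial map in graded coordinates: there are an orthonormal basis $(W_1,\dots,W_q)$ of $\mathfrak g$ made of bases of $V_1$ and $V_2$, a set $J\subset\{1,\dots,q\}$ with $q-p$ elements, and real polynomials $Q_j$, $j\in J$, in the $p$ variables $(y_i)_{i\notin J}$, such that $$\mathcal A=\Big\{\exp\Big(\sum_{i=1}^q y_iW_i\Big)\;:\;y\in\mathbb R^q,\ y_j=Q_j\big((y_i)_{i\notin J}\big)\text{ for all }j\in J\Big\},$$ where $y_i$ has degree $d_i=s$ if $W_i\in V_s$,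 and $Q_j$ is homogeneous of degree $d_j$ with respect to these degrees of the variables. -/

import Mathlib

open Set Filter Topology
open scoped Manifold ContDiff

/-- A two step stratified Lie algebra structure on a real vector space `𝔤`: a Lie bracket and a
decomposition `𝔤 = V₁ ⊕ V₂` with `[V₁, V₁] = V₂ ≠ 0` and `[V₁, V₂] = [V₂, V₂] = 0`.  The inner
product of `𝔤` is graded, i.e. the layers are orthogonal to each other. -/
structure TwoStepStratifiedAlgebra (𝔤 : Type*) [NormedAddCommGroup 𝔤] [InnerProductSpace ℝ 𝔤] where
  bracket : 𝔤 →ₗ[ℝ] 𝔤 →ₗ[ℝ] 𝔤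
  bracket_self : ∀ x, bracket x x = 0
  jacobi : ∀ x y z,
    bracket x (bracket y z) + bracket y (bracket z x) + bracket z (bracket x y) = 0
  V₁ : Submodule ℝ 𝔤
  V₂ : Submodule ℝ 𝔤
  isCompl : IsCompl V₁ V₂
  bracket_V₁_V₁ : Submodule.span ℝ {z | ∃ x ∈ V₁, ∃ y ∈ V₁, bracket x y = z} = V₂
  bracket_V₁_V₂ : ∀ x ∈ V₁, ∀ y ∈ V₂, bracket x y = 0
  bracket_V₂_V₂ : ∀ x ∈ V₂, ∀ y ∈ V₂, bracket x y = 0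
  V₂_ne_bot : V₂ ≠ ⊥
  orthogonal : ∀ x ∈ V₁, ∀ y ∈ V₂, inner ℝ x y = 0

namespace TwoStepStratifiedAlgebra

variable {𝔤 : Type*} [NormedAddCommGroup 𝔤] [InnerProductSpace ℝ 𝔤]
  (A : TwoStepStratifiedAlgebra 𝔤)

theorem bracket_skew (x y : 𝔤) : A.bracket x y = -A.bracket y x := by
  have h := A.bracket_self (x + y)
  simp only [map_add, LinearMap.add_apply, A.bracket_self, zero_add, add_zero] at h
  exact eq_neg_of_add_eq_zero_right h

theorem bracket_mem (x y : 𝔤) : A.bracket x y ∈ A.V₂ := by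
  have hx : x ∈ A.V₁ ⊔ A.V₂ := by rw [A.isCompl.sup_eq_top]; trivial
  have hy : y ∈ A.V₁ ⊔ A.V₂ := by rw [A.isCompl.sup_eq_top]; trivial
  obtain ⟨a, ha, b, hb, rfl⟩ := Submodule.mem_sup.1 hx
  obtain ⟨c, hc, d, hd, rfl⟩ := Submodule.mem_sup.1 hy
  have h1 : A.bracket b c = 0 := by rw [A.bracket_skew, A.bracket_V₁_V₂ c hc b hb, neg_zero]
  simp only [map_add, LinearMap.add_apply, h1, A.bracket_V₁_V₂ a ha d hd,
    A.bracket_V₂_V₂ b hb d hd, add_zero]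
  rw [← A.bracket_V₁_V₁]
  exact Submodule.subset_span ⟨a, ha, c, hc, rfl⟩

theorem bracket_bracket (x y z : 𝔤) : A.bracket x (A.bracket y z) = 0 := by
  have hx : x ∈ A.V₁ ⊔ A.V₂ := by rw [A.isCompl.sup_eq_top]; trivial
  obtain ⟨a, ha, b, hb, rfl⟩ := Submodule.mem_sup.1 hx
  simp only [map_add, LinearMap.add_apply, A.bracket_V₁_V₂ a ha _ (A.bracket_mem y z),
    A.bracket_V₂_V₂ b hb _ (A.bracket_mem y z), add_zero]

theorem bracket_bracket_left (x y z : 𝔤) : A.bracket (A.bracket x y) z = 0 := by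
  rw [A.bracket_skew, A.bracket_bracket, neg_zero]

/-- The connected, simply connected Lie group with Lie algebra `𝔤`, realized through its
exponential mapping: its points are `exp v` for a unique `v = log (exp v)` in `𝔤`, and
`exp x * exp y = exp (x + y + [x, y] / 2)` (the Baker-Campbell-Hausdorff formula in step two). -/
@[ext]
structure StratifiedGroup {𝔤 : Type*} [NormedAddCommGroup 𝔤] [InnerProductSpace ℝ 𝔤]
    (A : TwoStepStratifiedAlgebra 𝔤) where
  exp ::
  log : 𝔤

namespace StratifiedGroup

variable {A}

noncomputable instance : Mul A.StratifiedGroup :=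
  ⟨fun x y => exp (x.log + y.log + (1 / 2 : ℝ) • A.bracket x.log y.log)⟩

instance : One A.StratifiedGroup := ⟨exp 0⟩

instance : Inv A.StratifiedGroup := ⟨fun x => exp (-x.log)⟩

@[simp] theorem log_mul (x y : A.StratifiedGroup) :
    (x * y).log = x.log + y.log + (1 / 2 : ℝ) • A.bracket x.log y.log := rfl

@[simp] theorem log_one : (1 : A.StratifiedGroup).log = 0 := rfl

@[simp] theorem log_inv (x : A.StratifiedGroup) : x⁻¹.log = -x.log := rfl

noncomputable instance : Group A.StratifiedGroup :=
  Group.ofLeftAxioms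
    (fun x y z => by
      ext
      simp only [log_mul, map_add, map_smul, LinearMap.add_apply, LinearMap.smul_apply,
        A.bracket_bracket, A.bracket_bracket_left, smul_add, smul_zero]
      abel)
    (fun x => by ext; simp)
    (fun x => by ext; simp [A.bracket_self])

/-- The topology transported from `𝔤` by the exponential mapping. -/
instance : TopologicalSpace A.StratifiedGroup := TopologicalSpace.induced log inferInstance

/-- The exponential mapping, as a homeomorphism. -/
def expHomeomorph (A : TwoStepStratifiedAlgebra 𝔤) : 𝔤 ≃ₜ A.StratifiedGroup where
  toFun := exp
  invFun := log
  left_inv _ := rfl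
  right_inv _ := rfl
  continuous_toFun := continuous_induced_rng.2 continuous_id
  continuous_invFun := continuous_induced_dom

/-- The inverse of the exponential mapping is a global chart. -/
instance : ChartedSpace 𝔤 A.StratifiedGroup :=
  (expHomeomorph A).symm.toOpenPartialHomeomorph.singletonChartedSpace rfl

instance : IsManifold 𝓘(ℝ, 𝔤) ω A.StratifiedGroup :=
  (expHomeomorph A).symm.toOpenPartialHomeomorph.isManifold_singleton rfl

theorem contMDiff_exp : ContMDiff 𝓘(ℝ, 𝔤) 𝓘(ℝ, 𝔤) ω (exp : 𝔤 → A.StratifiedGroup) := by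
  rw [contMDiff_iff]
  exact ⟨(expHomeomorph A).continuous, fun x y => contDiffOn_id.congr fun z _ => rfl⟩

theorem contMDiff_log : ContMDiff 𝓘(ℝ, 𝔤) 𝓘(ℝ, 𝔤) ω (log : A.StratifiedGroup → 𝔤) := by
  rw [contMDiff_iff]
  exact ⟨(expHomeomorph A).symm.continuous, fun x y => contDiffOn_id.congr fun z _ => rfl⟩

instance [FiniteDimensional ℝ 𝔤] : LieGroup 𝓘(ℝ, 𝔤) ω A.StratifiedGroup where
  contMDiff_mul := by
    have hb : ContDiff ℝ ω (fun p : 𝔤 × 𝔤 => p.1 + p.2 + (1 / 2 : ℝ) • A.bracket p.1 p.2) :=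
      (contDiff_fst.add contDiff_snd).add (contDiff_const.smul
        ((A.bracket.toContinuousBilinearMap.contDiff.comp contDiff_fst).clm_apply contDiff_snd))
    have hl : ContMDiff (𝓘(ℝ, 𝔤).prod 𝓘(ℝ, 𝔤)) 𝓘(ℝ, 𝔤 × 𝔤) ω
        (fun p : A.StratifiedGroup × A.StratifiedGroup => (p.1.log, p.2.log)) :=
      (contMDiff_log.comp contMDiff_fst).prodMk_space (contMDiff_log.comp contMDiff_snd)
    exact contMDiff_exp.comp (hb.contMDiff.comp hl)
  contMDiff_inv := contMDiff_exp.comp (contDiff_neg.contMDiff.comp contMDiff_log)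

theorem mfderiv_exp (x : 𝔤) :
    mfderiv 𝓘(ℝ, 𝔤) 𝓘(ℝ, 𝔤) (exp : 𝔤 → A.StratifiedGroup) x = ContinuousLinearMap.id ℝ 𝔤 := by
  apply HasMFDerivAt.mfderiv
  exact ⟨(expHomeomorph A).continuous.continuousAt, (hasFDerivAt_id x).hasFDerivWithinAt⟩

theorem mfderiv_log (x : A.StratifiedGroup) :
    mfderiv 𝓘(ℝ, 𝔤) 𝓘(ℝ, 𝔤) (log : A.StratifiedGroup → 𝔤) x = ContinuousLinearMap.id ℝ 𝔤 := by
  apply HasMFDerivAt.mfderiv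
  exact ⟨(expHomeomorph A).symm.continuous.continuousAt, (hasFDerivAt_id _).hasFDerivWithinAt⟩

theorem mulInvariantVectorField_eq [FiniteDimensional ℝ 𝔤] (v : 𝔤) (g : A.StratifiedGroup) :
    (mulInvariantVectorField (I := 𝓘(ℝ, 𝔤)) (G := A.StratifiedGroup) v g : 𝔤) =
      v + (1 / 2 : ℝ) • A.bracket g.log v := by
  have h : HasMFDerivAt 𝓘(ℝ, 𝔤) 𝓘(ℝ, 𝔤) (fun x : A.StratifiedGroup => g * x) 1
      (ContinuousLinearMap.id ℝ 𝔤 + (1 / 2 : ℝ) • A.bracket.toContinuousBilinearMap g.log) := by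
    refine ⟨(contMDiff_mul_left (I := 𝓘(ℝ, 𝔤)) (n := ω)).continuous.continuousAt, ?_⟩
    have : HasFDerivAt (fun x : 𝔤 => g.log + x + (1 / 2 : ℝ) • A.bracket g.log x)
      (ContinuousLinearMap.id ℝ 𝔤 + (1 / 2 : ℝ) • A.bracket.toContinuousBilinearMap g.log) 0 :=
      ((hasFDerivAt_id (0 : 𝔤)).const_add g.log).add
        ((A.bracket.toContinuousBilinearMap g.log).hasFDerivAt.const_smul (1 / 2 : ℝ))
    exact this.hasFDerivWithinAt
  unfold mulInvariantVectorField
  rw [h.mfderiv]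
  rfl

theorem mpullbackWithin_mulInvariantVectorField [FiniteDimensional ℝ 𝔤] (v x : 𝔤) :
    (VectorField.mpullbackWithin 𝓘(ℝ, 𝔤) 𝓘(ℝ, 𝔤) (exp : 𝔤 → A.StratifiedGroup)
      (mulInvariantVectorField (I := 𝓘(ℝ, 𝔤)) (G := A.StratifiedGroup) v)
      (range 𝓘(ℝ, 𝔤)) x : 𝔤) = v + (1 / 2 : ℝ) • A.bracket x v := by
  have h1 : mfderivWithin 𝓘(ℝ, 𝔤) 𝓘(ℝ, 𝔤) (exp : 𝔤 → A.StratifiedGroup) (range 𝓘(ℝ, 𝔤)) x =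
      ContinuousLinearMap.id ℝ 𝔤 := by
    rw [ModelWithCorners.range_eq_univ, mfderivWithin_univ, mfderiv_exp]
  have h2 := congrArg (fun L : 𝔤 →L[ℝ] 𝔤 => L.inverse
    (mulInvariantVectorField (I := 𝓘(ℝ, 𝔤)) (G := A.StratifiedGroup) v (exp x))) h1
  refine Eq.trans h2 ?_
  simp only [ContinuousLinearMap.inverse_id]
  exact mulInvariantVectorField_eq v (exp x : A.StratifiedGroup)

theorem lieBracketWithin_eq [FiniteDimensional ℝ 𝔤] (v w : 𝔤) :
    VectorField.lieBracketWithin ℝ (V := fun x : 𝔤 => v + (1 / 2 : ℝ) • A.bracket x v)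
      (W := fun x : 𝔤 => w + (1 / 2 : ℝ) • A.bracket x w) univ 0 = A.bracket v w := by
  have hd : ∀ u : 𝔤, HasFDerivAt (fun x : 𝔤 => u + (1 / 2 : ℝ) • A.bracket x u)
      ((1 / 2 : ℝ) • A.bracket.toContinuousBilinearMap.flip u) 0 := fun u =>
    ((A.bracket.toContinuousBilinearMap.flip u).hasFDerivAt.const_smul (1 / 2 : ℝ)).const_add u
  rw [VectorField.lieBracketWithin_univ, VectorField.lieBracket_eq]
  beta_reduce
  rw [(hd v).fderiv, (hd w).fderiv]
  change (1 / 2 : ℝ) • A.bracket (v + (1 / 2 : ℝ) • A.bracket 0 v) w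
    - (1 / 2 : ℝ) • A.bracket (w + (1 / 2 : ℝ) • A.bracket 0 w) v = A.bracket v w
  simp only [map_zero, LinearMap.zero_apply, smul_zero, add_zero]
  rw [A.bracket_skew w v, smul_neg, sub_neg_eq_add, ← add_smul]
  norm_num

/-- The Lie algebra of the group is `𝔤` with the given bracket. -/
theorem groupLieAlgebra_bracket [FiniteDimensional ℝ 𝔤]
    (v w : GroupLieAlgebra 𝓘(ℝ, 𝔤) A.StratifiedGroup) :
    ⁅v, w⁆ = A.bracket v w := by
  have h2 : mfderiv 𝓘(ℝ, 𝔤) 𝓘(ℝ, 𝔤) (log : A.StratifiedGroup → 𝔤) 1 =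
      ContinuousLinearMap.id ℝ 𝔤 := mfderiv_log 1
  have h3 : (exp : 𝔤 → A.StratifiedGroup) ⁻¹' univ ∩ range 𝓘(ℝ, 𝔤) = univ := by simp
  have h4 := lieBracketWithin_eq (A := A) v w
  rw [← funext (mpullbackWithin_mulInvariantVectorField (A := A) v),
    ← funext (mpullbackWithin_mulInvariantVectorField (A := A) w), ← h3] at h4
  have h5 := congrArg (fun L : 𝔤 →L[ℝ] 𝔤 => L.inverse (A.bracket v w)) h2
  simp only [ContinuousLinearMap.inverse_id] at h5
  refine Eq.trans ?_ h5
  rw [← h4]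
  rfl

instance : SimplyConnectedSpace A.StratifiedGroup :=
  have : ContractibleSpace A.StratifiedGroup := (expHomeomorph A).symm.contractibleSpace
  inferInstance

/-- The dilation `δ_r`: in exponential coordinates, `δ_r (v₁ + v₂) = r v₁ + r² v₂` for
`v₁ ∈ V₁`, `v₂ ∈ V₂`. -/
noncomputable def dilation (r : ℝ) (x : A.StratifiedGroup) : A.StratifiedGroup :=
  exp (r • A.V₁.projection A.V₂ A.isCompl x.log + r ^ 2 • A.V₂.projection A.V₁ A.isCompl.symm x.log)

/-- The rescaled set `δ_{1/r} (x⁻¹ S)`. -/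
noncomputable def rescale (S : Set A.StratifiedGroup) (x : A.StratifiedGroup) (r : ℝ) :
    Set A.StratifiedGroup :=
  (fun y => dilation (1 / r) (x⁻¹ * y)) '' S

/-- A `p`-dimensional (embedded) submanifold of class `C²`: around each of its points it is the
zero set of a `C²` map with values in `ℝᵏ`, `k` being the codimension, whose differential is
surjective at the zeros. -/
def IsC2Submanifold (p : ℕ) (S : Set A.StratifiedGroup) : Prop :=
  ∃ k : ℕ, p + k = Module.finrank ℝ 𝔤 ∧ ∀ x ∈ S, ∃ V : Set A.StratifiedGroup, IsOpen V ∧ x ∈ V ∧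
    ∃ f : A.StratifiedGroup → EuclideanSpace ℝ (Fin k),
      ContMDiffOn 𝓘(ℝ, 𝔤) 𝓘(ℝ, EuclideanSpace ℝ (Fin k)) 2 f V ∧
      S ∩ V = {s ∈ V | f s = 0} ∧
      ∀ s ∈ S ∩ V, Function.Surjective
        (mfderiv 𝓘(ℝ, 𝔤) 𝓘(ℝ, EuclideanSpace ℝ (Fin k)) f s)

/-- A map `P : G → ℝᵏ` is polynomial if `P ∘ exp` has polynomial components in the coordinates of
some basis of `𝔤`. -/
def IsPolynomial {k : ℕ} (P : A.StratifiedGroup → Fin k → ℝ) : Prop :=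
  ∃ (b : Module.Basis (Fin (Module.finrank ℝ 𝔤)) ℝ 𝔤)
    (p : Fin k → MvPolynomial (Fin (Module.finrank ℝ 𝔤)) ℝ),
    ∀ v j, P (exp v) j = MvPolynomial.eval (fun i => b.repr v i) (p j)

/-- A homogeneous algebraic variety: the zero set of a polynomial map that is mapped into itself
by all dilations. -/
def IsHomogeneousAlgebraicVariety (T : Set A.StratifiedGroup) : Prop :=
  (∃ k : ℕ, 1 ≤ k ∧ ∃ P : A.StratifiedGroup → Fin k → ℝ, IsPolynomial P ∧ T = {x | P x = 0}) ∧
    ∀ r : ℝ, 0 < r → dilation r '' T ⊆ T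

variable (A) in
/-- Indices of graded coordinates, those of the first layer and those of the second layer. -/
noncomputable abbrev CoordIndex : Type :=
  Fin (Module.finrank ℝ A.V₁) ⊕ Fin (Module.finrank ℝ A.V₂)

/-- The degree of a graded coordinate. -/
noncomputable def coordDegree : CoordIndex A → ℕ := Sum.elim (fun _ => 1) (fun _ => 2)

variable (A) in
/-- A graded basis: an orthonormal basis of `𝔤` consisting of bases of the layers. -/
structure GradedBasis where
  basis : OrthonormalBasis (CoordIndex A) ℝ 𝔤
  mem_V₁ : ∀ i, basis (Sum.inl i) ∈ A.V₁
  mem_V₂ : ∀ i, basis (Sum.inr i) ∈ A.V₂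

/-- The system of graded coordinates `F(y) = exp (∑ yᵢ Wᵢ)` of a graded basis `W`. -/
noncomputable def GradedBasis.coords (W : GradedBasis A) (y : CoordIndex A → ℝ) : A.StratifiedGroup :=
  exp (∑ i, y i • W.basis i)

/-- `T` is, in some system of graded coordinates, the graph of a homogeneous polynomial map of `p`
variables: the coordinates `yⱼ` with `j ∈ J` are polynomials `Q j` of the `p` remaining ones, and
`Q j` is homogeneous, with respect to the degrees of the coordinates, of the degree of `yⱼ`. -/
def IsHomogeneousPolynomialGraph (p : ℕ) (T : Set A.StratifiedGroup) : Prop :=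
  ∃ (W : GradedBasis A) (J : Finset (CoordIndex A))
    (Q : {j // j ∈ J} → MvPolynomial {i // i ∉ J} ℝ),
    p + J.card = Fintype.card (CoordIndex A) ∧
    (∀ j, (Q j).IsWeightedHomogeneous (fun i => coordDegree i.1) (coordDegree j.1)) ∧
    T = W.coords '' {y | ∀ j, y j.1 = MvPolynomial.eval (fun i => y i.1) (Q j)}

variable (A) in
/-- A homogeneous distance: a continuous, left invariant distance that is homogeneous with respect
to dilations. -/
structure HomogeneousDistance where
  dist : A.StratifiedGroup → A.StratifiedGroup → ℝ
  dist_self : ∀ x, dist x x = 0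
  eq_of_dist_eq_zero : ∀ {x y}, dist x y = 0 → x = y
  dist_comm : ∀ x y, dist x y = dist y x
  dist_triangle : ∀ x y z, dist x z ≤ dist x y + dist y z
  continuous_dist : Continuous fun z : A.StratifiedGroup × A.StratifiedGroup => dist z.1 z.2
  dist_mul_left : ∀ u x y, dist (u * x) (u * y) = dist x y
  dist_dilation : ∀ r : ℝ, 0 < r → ∀ x y, dist (dilation r x) (dilation r y) = r * dist x y

namespace HomogeneousDistance

/-- The metric space structure given by a homogeneous distance. -/
@[reducible] noncomputable def toMetricSpace (ρ : HomogeneousDistance A) :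
    MetricSpace A.StratifiedGroup where
  dist := ρ.dist
  dist_self := ρ.dist_self
  dist_comm := ρ.dist_comm
  dist_triangle := ρ.dist_triangle
  eq_of_dist_eq_zero := ρ.eq_of_dist_eq_zero

/-- The closed ball of radius `R` centered at the unit element. -/
def closedBall (ρ : HomogeneousDistance A) (R : ℝ) : Set A.StratifiedGroup :=
  {y | ρ.dist 1 y ≤ R}

/-- The Hausdorff distance of two sets with respect to a homogeneous distance. -/
noncomputable def hausdorffEDist (ρ : HomogeneousDistance A) (S T : Set A.StratifiedGroup) :
    ENNReal :=
  letI := ρ.toMetricSpace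
  Metric.hausdorffEDist S T

/-- Local convergence, as `r → 0⁺`, of a family of sets with respect to the Hausdorff distance. -/
def LocallyConvergesTo (ρ : HomogeneousDistance A) (S : ℝ → Set A.StratifiedGroup)
    (T : Set A.StratifiedGroup) : Prop :=
  ∀ R : ℝ, 0 < R → Tendsto (fun r => ρ.hausdorffEDist (S r ∩ ρ.closedBall R) (T ∩ ρ.closedBall R))
    (𝓝[>] 0) (𝓝 0)

end HomogeneousDistance

end StratifiedGroup
end TwoStepStratifiedAlgebra

/-! In exponential coordinates centered at `x` the submanifold is `{g = 0}` with `g` of class C², `L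
= Dg(0)` surjective and `B = D²g(0)`. The rescaled set consists of the points `a + b`, `a ∈ V₁`, `b
∈ V₂`, with `g (r a + r² b) = 0`, and Taylor's formula gives `r⁻² g (r a + r² b) = r⁻¹ L a + L b + ½
B(a, a) + o(1)`. At zeros of `g`, multiplying by `r` forces `L a = 0` in the limit. The term `r⁻¹ L
a` need not converge, but it stays in the closed subspace `L(V₁)`, so `L b + ½ B(a, a) ∈ L(V₁)` in
the limit. These two conditions define `blowUp`.

Conversely, if `L b + ½ B(a, a) = L u` with `u ∈ V₁`, replacing `a` by `a - r u` makes `g` of size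
`o(r²)`. Metric regularity then yields a true zero at distance `o(r²)`, an error that disappears
after applying `δ_{1/r}`.

This pointwise convergence becomes Hausdorff convergence on balls by compactness, and dilation
invariance of the limit handles the boundary of the ball. The limit depends on `g` alone, so it
serves all homogeneous distances. Modulo `L(V₁)` the second condition can be solved for some
coordinates of `b` as quadratic polynomials in `a`; surjectivity of `L` gives the right number of
dependent coordinates. -/

/-! ### Second order Taylor expansion and metric regularity -/

section Calculus

variable {E F : Type*} [NormedAddCommGroup E] [NormedSpace ℝ E] [NormedAddCommGroup F]
  [NormedSpace ℝ F]

/-- Taylor's formula of order two, with the remainder in the form of Peano. -/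
theorem ContDiffAt.isLittleO_taylor_two {g : E → F} {a : E} (hg : ContDiffAt ℝ 2 g a) :
    (fun w => g (a + w) - g a - fderiv ℝ g a w
      - (1 / 2 : ℝ) • fderiv ℝ (fderiv ℝ g) a w w) =o[𝓝 0] fun w => ‖w‖ ^ 2 := by
  have hsymm : IsSymmSndFDerivAt ℝ g a := hg.isSymmSndFDerivAt (by simp)
  have hD : DifferentiableAt ℝ (fderiv ℝ g) a :=
    (hg.fderiv_right (m := 1) (by norm_num)).differentiableAt (by simp)
  have hev : ∀ᶠ y in 𝓝 a, HasFDerivAt g (fderiv ℝ g y) y := by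
    filter_upwards [hg.eventually (by simp)] with y hy
    exact (hy.differentiableAt (by simp)).hasFDerivAt
  have hadd : Tendsto (fun w : E => a + w) (𝓝 0) (𝓝 a) := by
    have : Continuous fun w : E => a + w := by fun_prop
    simpa using this.tendsto 0
  have hev' := hadd.eventually hev
  have hlo := hasFDerivAt_iff_isLittleO_nhds_zero.1 hD.hasFDerivAt
  set B := fderiv ℝ (fderiv ℝ g) a with hB
  refine Asymptotics.isLittleO_iff.2 fun c hc => ?_
  have h1 := (Asymptotics.isLittleO_iff.1 hlo hc).and hev'
  obtain ⟨ε, hε, hball⟩ := Metric.eventually_nhds_iff_ball.1 h1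
  filter_upwards [Metric.ball_mem_nhds (0 : E) hε] with w hw
  -- By symmetry of `B` the remainder has derivative `Dg(a + y) - Dg(a) - B y`, which is `o(‖y‖)`
  -- since `Dg` is differentiable at `a`; the mean value inequality on the ball of radius `‖w‖`
  -- concludes.
  have key : ∀ y ∈ Metric.closedBall (0 : E) ‖w‖, HasFDerivWithinAt
      (fun w => g (a + w) - g a - fderiv ℝ g a w - (1 / 2 : ℝ) • B w w)
      (fderiv ℝ g (a + y) - fderiv ℝ g a - B y) (Metric.closedBall (0 : E) ‖w‖) y := by
    intro y hy
    have hy' : y ∈ Metric.ball (0 : E) ε := by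
      simp only [Metric.mem_closedBall, Metric.mem_ball, dist_zero_right] at hy hw ⊢
      exact lt_of_le_of_lt hy hw
    have d1 : HasFDerivAt (fun w => g (a + w)) (fderiv ℝ g (a + y)) y := by
      exact (hball y hy').2.comp y ((hasFDerivAt_id y).const_add a)
    have d2 : HasFDerivAt (fun w => B w w) (B y + B.flip y) y := by
      exact B.hasFDerivAt (x := y) |>.clm_apply (hasFDerivAt_id y)
    have d3 := ((d1.sub_const (g a)).sub (fderiv ℝ g a).hasFDerivAt).sub (d2.const_smul (1 / 2 : ℝ))
    refine HasFDerivWithinAt.congr_fderiv (f := fun w => g (a + w) - g a - fderiv ℝ g a w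
      - (1 / 2 : ℝ) • B w w) d3.hasFDerivWithinAt ?_
    ext v
    have hs : B v y = B y v := hsymm v y
    change fderiv ℝ g (a + y) v - fderiv ℝ g a v - (1 / 2 : ℝ) • (B y v + B v y)
      = fderiv ℝ g (a + y) v - fderiv ℝ g a v - B y v
    rw [hs, ← two_smul ℝ (B y v), smul_smul]
    norm_num
  have bound : ∀ y ∈ Metric.closedBall (0 : E) ‖w‖,
      ‖fderiv ℝ g (a + y) - fderiv ℝ g a - B y‖ ≤ c * ‖w‖ := by
    intro y hy
    simp only [Metric.mem_closedBall, Metric.mem_ball, dist_zero_right] at hy hw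
    have := (hball y (by simpa using lt_of_le_of_lt hy hw)).1
    exact this.trans (by gcongr)
  have := (convex_closedBall (0 : E) ‖w‖).norm_image_sub_le_of_norm_hasFDerivWithin_le key bound
    (x := 0) (y := w) (by simp) (by simp)
  simp only [add_zero, sub_self, map_zero, smul_zero, sub_zero] at this
  rw [Real.norm_of_nonneg (by positivity : (0 : ℝ) ≤ ‖w‖ ^ 2)]
  linarith [this, mul_assoc c ‖w‖ ‖w‖, sq ‖w‖]

/-- Metric regularity of a strictly differentiable map with surjective differential: near a zero
of the map, the distance to the zero set is controlled by the values of the map. -/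
theorem HasStrictFDerivAt.exists_zero_of_surjective [CompleteSpace E] [CompleteSpace F] {g : E → F}
    {L : E →L[ℝ] F} {a : E} (hg : HasStrictFDerivAt g L a) (hL : Function.Surjective L)
    (ha : g a = 0) :
    ∃ C : ℝ, 0 ≤ C ∧ ∀ᶠ w in 𝓝 a, ∃ w', g w' = 0 ∧ ‖w' - w‖ ≤ C * ‖g w‖ := by
  have hr : (L : E →ₗ[ℝ] F).range = ⊤ := LinearMap.range_eq_top.2 hL
  set R := L.nonlinearRightInverseOfSurjective hr with hR
  have hpos : 0 < R.nnnorm := L.nonlinearRightInverseOfSurjective_nnnorm_pos hr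
  -- With half the critical constant, the image of the ball of radius `2 ‖R‖ ‖g w‖` about `w` covers
  -- the ball of radius `‖g w‖` about `g w`, hence contains `0`.
  obtain ⟨s, hs, happ⟩ := hg.approximates_deriv_on_nhds (c := R.nnnorm⁻¹ / 2)
    (Or.inr (half_pos (inv_pos.2 hpos)))
  obtain ⟨ε, hε, hball⟩ := Metric.mem_nhds_iff.1 hs
  have hpos' : (0 : ℝ) < R.nnnorm := hpos
  refine ⟨2 * R.nnnorm, by positivity, ?_⟩
  -- Since `g a = 0`, the ball to be covered stays inside `s` for `w` near `a`.
  have ht : Tendsto (fun w => dist w a + 2 * R.nnnorm * ‖g w‖) (𝓝 a) (𝓝 0) := by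
    have hc : ContinuousAt (fun w => dist w a + 2 * R.nnnorm * ‖g w‖) a :=
      (continuousAt_id.dist continuousAt_const).add
        (continuousAt_const.mul hg.hasFDerivAt.continuousAt.norm)
    simpa [ContinuousAt, ha] using hc
  filter_upwards [ht.eventually_lt_const hε] with w hw
  have hsub : Metric.closedBall w (2 * R.nnnorm * ‖g w‖) ⊆ s := by
    intro y hy
    apply hball
    rw [Metric.mem_closedBall] at hy
    rw [Metric.mem_ball]
    linarith [dist_triangle y w a]
  have hsurj := happ.surjOn_closedBall_of_nonlinearRightInverse R (by positivity) hsub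
  have h0 : (0 : F) ∈ Metric.closedBall (g w)
      (((R.nnnorm : ℝ)⁻¹ - (R.nnnorm⁻¹ / 2 : NNReal)) * (2 * R.nnnorm * ‖g w‖)) := by
    rw [Metric.mem_closedBall, dist_zero_left]
    apply le_of_eq
    push_cast
    field_simp
    norm_num
  obtain ⟨w', hw', h⟩ := hsurj h0
  exact ⟨w', h, by simpa [dist_eq_norm] using hw'⟩

/-- The anisotropic second order expansion of `g (r a + r² b)`. -/
theorem tendsto_anisotropic_taylor {α : Type*} {l : Filter α} {g : E → F} {L : E →L[ℝ] F}
    {B : E →L[ℝ] E →L[ℝ] F}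
    (hg : (fun w => g w - L w - (1 / 2 : ℝ) • B w w) =o[𝓝 0] fun w => ‖w‖ ^ 2)
    {r : α → ℝ} {a b : α → E} {a₀ b₀ : E} (hr : Tendsto r l (𝓝 0)) (hr0 : ∀ᶠ t in l, r t ≠ 0)
    (ha : Tendsto a l (𝓝 a₀)) (hb : Tendsto b l (𝓝 b₀)) :
    Tendsto (fun t => (r t ^ 2)⁻¹ • g (r t • a t + r t ^ 2 • b t) - (r t)⁻¹ • L (a t)) l
      (𝓝 (L b₀ + (1 / 2 : ℝ) • B a₀ a₀)) := by
  have hd : Tendsto (fun t => a t + r t • b t) l (𝓝 a₀) := by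
    simpa using ha.add (hr.smul hb)
  have hw : Tendsto (fun t => r t • a t + r t ^ 2 • b t) l (𝓝 0) := by
    simpa using (hr.smul ha).add ((hr.pow 2).smul hb)
  -- The argument is `r (a + r b) = O(r)`, so the Taylor remainder is `o(r²)` and survives division
  -- by `r²`.
  have hbig : (fun t => ‖r t • a t + r t ^ 2 • b t‖ ^ 2) =O[l] fun t => r t ^ 2 := by
    have h1 : (fun t => r t • (a t + r t • b t)) =O[l] fun t => r t := by
      simpa using (Asymptotics.isBigO_refl r l).smul (hd.isBigO_one ℝ)
    have h2 := h1.norm_left.pow 2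
    refine h2.congr_left fun t => ?_
    rw [smul_add, smul_smul, sq (r t)]
  have hlo := (hg.comp_tendsto hw).trans_isBigO hbig
  have hrem := (Asymptotics.isLittleO_iff_tendsto' (by
    filter_upwards [hr0] with t ht h using absurd h (by positivity))).1 hlo.norm_left
  have hrem' : Tendsto (fun t => (r t ^ 2)⁻¹ • (g (r t • a t + r t ^ 2 • b t)
      - L (r t • a t + r t ^ 2 • b t)
      - (1 / 2 : ℝ) • B (r t • a t + r t ^ 2 • b t) (r t • a t + r t ^ 2 • b t))) l (𝓝 0) := by
    rw [tendsto_zero_iff_norm_tendsto_zero]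
    refine hrem.congr fun t => ?_
    simp only [Function.comp_apply]
    rw [norm_smul, norm_inv, norm_pow, Real.norm_eq_abs, sq_abs, div_eq_inv_mul]
  have hB : Tendsto (fun t => L (b t)
      + (1 / 2 : ℝ) • B (a t + r t • b t) (a t + r t • b t)) l
      (𝓝 (L b₀ + (1 / 2 : ℝ) • B a₀ a₀)) := by
    have hc : Continuous fun v : E => (1 / 2 : ℝ) • B v v := by fun_prop
    exact ((L.continuous.tendsto b₀).comp hb).add ((hc.tendsto a₀).comp hd)
  have hsum := hB.add hrem'
  rw [add_zero] at hsum
  refine hsum.congr' ?_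
  filter_upwards [hr0] with t ht
  have e1 : r t • a t + r t ^ 2 • b t = r t • (a t + r t • b t) := by
    rw [smul_add, smul_smul, sq]
  have e2 : (r t ^ 2)⁻¹ * r t = (r t)⁻¹ := by field_simp
  have e3 : (r t)⁻¹ * r t = 1 := by field_simp
  rw [e1, map_smul L, map_smul B, smul_apply, map_smul (B _)]
  set v := a t + r t • b t with hv
  have e4 : L v = L (a t) + r t • L (b t) := by rw [hv, map_add, map_smul]
  simp only [smul_sub, smul_smul, e2]
  rw [e4]
  have e5 : (r t ^ 2)⁻¹ * (1 / 2 * (r t * r t)) = 1 / 2 := by field_simp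
  simp only [smul_add, smul_smul, e3, one_smul] at e5 ⊢
  rw [e5]
  abel

end Calculus

/-! ### Orthonormal bases adapted to a subspace -/

/-- A subspace of a Euclidean space admits an orthonormal basis of the whole space adapted to it:
the subspace is given by the vanishing of some of the coordinates. -/
theorem Submodule.exists_orthonormalBasis_adapted {V : Type*} [NormedAddCommGroup V]
    [InnerProductSpace ℝ V] [FiniteDimensional ℝ V] (N : Submodule ℝ V) :
    ∃ (b : OrthonormalBasis (Fin (Module.finrank ℝ V)) ℝ V)
      (J : Finset (Fin (Module.finrank ℝ V))),
      J.card + Module.finrank ℝ N = Module.finrank ℝ V ∧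
      ∀ v, v ∈ N ↔ ∀ j ∈ J, inner ℝ (b j) v = 0 := by
  have hdim : Module.finrank ℝ N + Module.finrank ℝ Nᗮ = Module.finrank ℝ V :=
    N.finrank_add_finrank_orthogonal
  let e : Fin (Module.finrank ℝ N) ⊕ Fin (Module.finrank ℝ Nᗮ) ≃ Fin (Module.finrank ℝ V) :=
    finSumFinEquiv.trans (finCongr hdim)
  -- Bases of `N` and `Nᗮ` are concatenated; `J` marks the vectors of `Nᗮ`, and `N = Nᗮᗮ`.
  let b₀ := ((stdOrthonormalBasis ℝ N).prod (stdOrthonormalBasis ℝ Nᗮ)).map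
    N.orthogonalDecomposition.symm
  have hb₀ : ∀ i, b₀ (Sum.inr i) = stdOrthonormalBasis ℝ Nᗮ i := by
    intro i
    simp only [b₀, OrthonormalBasis.map_apply]
    rw [LinearIsometryEquiv.symm_apply_eq, Submodule.orthogonalDecomposition_apply]
    have h := N.orthogonalProjectionOnto_eq_zero_iff.2 (stdOrthonormalBasis ℝ Nᗮ i).2
    simp [h]
  refine ⟨b₀.reindex e, Finset.univ.image (fun i => e (Sum.inr i)), ?_, fun v => ?_⟩
  · rw [Finset.card_image_of_injective _ fun _ _ h => Sum.inr_injective (e.injective h), Finset.card_univ,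
      Fintype.card_fin]
    omega
  · simp only [Finset.mem_image, Finset.mem_univ, true_and, forall_exists_index,
      forall_apply_eq_imp_iff, OrthonormalBasis.reindex_apply, Equiv.symm_apply_apply, hb₀]
    constructor
    · intro hv i
      exact Submodule.inner_left_of_mem_orthogonal hv (Subtype.coe_prop _)
    · intro h
      rw [← Submodule.orthogonal_orthogonal N, Submodule.mem_orthogonal]
      intro u hu
      have hu' := (stdOrthonormalBasis ℝ Nᗮ).sum_repr ⟨u, hu⟩
      have hu2 : u = ∑ i, (stdOrthonormalBasis ℝ Nᗮ).repr ⟨u, hu⟩ i •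
          (stdOrthonormalBasis ℝ Nᗮ i : V) := by
        have := congrArg (Subtype.val) hu'
        simpa using this.symm
      rw [hu2, sum_inner]
      exact Finset.sum_eq_zero fun i _ => by rw [inner_smul_left, h i, mul_zero]

/-! ### Layer projections and dilations -/

namespace TwoStepStratifiedAlgebra

variable {𝔤 : Type*} [NormedAddCommGroup 𝔤] [InnerProductSpace ℝ 𝔤]
  (A : TwoStepStratifiedAlgebra 𝔤)

/-- The projection onto the first layer. -/
noncomputable def proj₁ : 𝔤 →ₗ[ℝ] 𝔤 := A.V₁.projection A.V₂ A.isCompl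

/-- The projection onto the second layer. -/
noncomputable def proj₂ : 𝔤 →ₗ[ℝ] 𝔤 := A.V₂.projection A.V₁ A.isCompl.symm

theorem proj₁_mem (v : 𝔤) : A.proj₁ v ∈ A.V₁ := Submodule.projection_apply_mem _ _

theorem proj₂_mem (v : 𝔤) : A.proj₂ v ∈ A.V₂ := Submodule.projection_apply_mem _ _

theorem proj₁_add_proj₂ (v : 𝔤) : A.proj₁ v + A.proj₂ v = v :=
  Submodule.projection_add_projection_eq_self _ _

theorem proj₁_of_mem_V₁ {v : 𝔤} (hv : v ∈ A.V₁) : A.proj₁ v = v :=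
  Submodule.projection_apply_of_mem_left _ hv

theorem proj₂_of_mem_V₂ {v : 𝔤} (hv : v ∈ A.V₂) : A.proj₂ v = v :=
  Submodule.projection_apply_of_mem_left _ hv

theorem proj₁_of_mem_V₂ {v : 𝔤} (hv : v ∈ A.V₂) : A.proj₁ v = 0 := by
  simpa [A.proj₂_of_mem_V₂ hv] using A.proj₁_add_proj₂ v

theorem proj₂_of_mem_V₁ {v : 𝔤} (hv : v ∈ A.V₁) : A.proj₂ v = 0 := by
  simpa [A.proj₁_of_mem_V₁ hv] using A.proj₁_add_proj₂ v

@[simp] theorem proj₁_proj₁ (v : 𝔤) : A.proj₁ (A.proj₁ v) = A.proj₁ v :=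
  A.proj₁_of_mem_V₁ (A.proj₁_mem v)

@[simp] theorem proj₂_proj₂ (v : 𝔤) : A.proj₂ (A.proj₂ v) = A.proj₂ v :=
  A.proj₂_of_mem_V₂ (A.proj₂_mem v)

@[simp] theorem proj₁_proj₂ (v : 𝔤) : A.proj₁ (A.proj₂ v) = 0 :=
  A.proj₁_of_mem_V₂ (A.proj₂_mem v)

@[simp] theorem proj₂_proj₁ (v : 𝔤) : A.proj₂ (A.proj₁ v) = 0 :=
  A.proj₂_of_mem_V₁ (A.proj₁_mem v)

namespace StratifiedGroup

variable {A}

theorem log_dilation (r : ℝ) (x : A.StratifiedGroup) :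
    (dilation r x).log = r • A.proj₁ x.log + r ^ 2 • A.proj₂ x.log := rfl

theorem proj₁_log_dilation (r : ℝ) (x : A.StratifiedGroup) :
    A.proj₁ (dilation r x).log = r • A.proj₁ x.log := by
  simp [log_dilation]

theorem proj₂_log_dilation (r : ℝ) (x : A.StratifiedGroup) :
    A.proj₂ (dilation r x).log = r ^ 2 • A.proj₂ x.log := by
  simp [log_dilation]

theorem dilation_dilation (r s : ℝ) (x : A.StratifiedGroup) :
    dilation r (dilation s x) = dilation (r * s) x := by
  ext
  rw [log_dilation, proj₁_log_dilation, proj₂_log_dilation, log_dilation, smul_smul, smul_smul,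
    mul_pow]

@[simp] theorem dilation_one_left (x : A.StratifiedGroup) : dilation 1 x = x := by
  ext
  rw [log_dilation, one_pow, one_smul, one_smul, A.proj₁_add_proj₂]

@[simp] theorem dilation_zero_left (x : A.StratifiedGroup) : dilation 0 x = 1 := by
  ext
  simp [log_dilation]

@[simp] theorem dilation_one (r : ℝ) : dilation r (1 : A.StratifiedGroup) = 1 := by
  ext
  simp [log_dilation]

theorem mem_rescale_iff {S : Set A.StratifiedGroup} {x z : A.StratifiedGroup} {r : ℝ}
    (hr : r ≠ 0) : z ∈ rescale S x r ↔ x * dilation r z ∈ S := by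
  constructor
  · rintro ⟨y, hy, rfl⟩
    simpa [dilation_dilation, hr] using hy
  · intro h
    exact ⟨_, h, by simp [dilation_dilation, hr]⟩

theorem continuous_log : Continuous (log : A.StratifiedGroup → 𝔤) :=
  (expHomeomorph A).symm.continuous

theorem continuous_exp : Continuous (exp : 𝔤 → A.StratifiedGroup) :=
  (expHomeomorph A).continuous

theorem continuous_dilation [FiniteDimensional ℝ 𝔤] :
    Continuous fun q : ℝ × A.StratifiedGroup => dilation q.1 q.2 := by
  have h1 : Continuous A.proj₁ := A.proj₁.continuous_of_finiteDimensional
  have h2 : Continuous A.proj₂ := A.proj₂.continuous_of_finiteDimensional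
  have hl : Continuous fun q : ℝ × A.StratifiedGroup => q.2.log :=
    continuous_log.comp continuous_snd
  exact continuous_exp.comp ((continuous_fst.smul (h1.comp hl)).add
    ((continuous_fst.pow 2).smul (h2.comp hl)))

/-! ### Homogeneous distances and a criterion for Hausdorff convergence -/

namespace HomogeneousDistance

variable (ρ : HomogeneousDistance A)

theorem dist_one_dilation {r : ℝ} (hr : 0 < r) (y : A.StratifiedGroup) :
    ρ.dist 1 (dilation r y) = r * ρ.dist 1 y := by
  simpa using ρ.dist_dilation r hr 1 y

theorem dist_nonneg (x y : A.StratifiedGroup) : 0 ≤ ρ.dist x y := by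
  have := ρ.dist_triangle x y x
  rw [ρ.dist_self, ρ.dist_comm y x] at this
  linarith

theorem continuous_dist_right (x : A.StratifiedGroup) : Continuous fun y => ρ.dist x y :=
  ρ.continuous_dist.comp (by fun_prop : Continuous fun y => (x, y))

theorem continuous_dist_left (y : A.StratifiedGroup) : Continuous fun x => ρ.dist x y :=
  ρ.continuous_dist.comp (by fun_prop : Continuous fun x => (x, y))

theorem isClosed_closedBall (R : ℝ) : IsClosed (ρ.closedBall R) :=
  isClosed_le (ρ.continuous_dist_right 1) continuous_const

/-- On the Euclidean unit sphere the distance to the unit is bounded below by some `c > 0`. A point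
of the ball with norm at least one is dilated onto that sphere by some `s`, found by the
intermediate value theorem, and homogeneity gives `s⁻¹ ≤ R / c`. The ball is thus a closed subset of
a compact set. -/
theorem isCompact_closedBall [FiniteDimensional ℝ 𝔤] (R : ℝ) :
    IsCompact (ρ.closedBall R) := by
  have hsphere : IsCompact (exp '' Metric.sphere (0 : 𝔤) 1 : Set A.StratifiedGroup) :=
    (isCompact_sphere 0 1).image continuous_exp
  have hball : IsCompact (exp '' Metric.closedBall (0 : 𝔤) 1 : Set A.StratifiedGroup) :=
    (ProperSpace.isCompact_closedBall (0 : 𝔤) 1).image continuous_exp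
  obtain ⟨c, hc, hmin⟩ := hsphere.exists_forall_le' (a := 0) (ρ.continuous_dist_right 1).continuousOn
    (by
      rintro _ ⟨v, hv, rfl⟩
      refine lt_of_le_of_ne (ρ.dist_nonneg _ _) fun h => ?_
      have hv0 : (0 : 𝔤) = v := congrArg log (ρ.eq_of_dist_eq_zero h.symm)
      simp [← hv0] at hv)
  refine (hball.union (((isCompact_Icc (a := 0) (b := R / c)).prod hsphere).image
    continuous_dilation)).of_isClosed_subset (ρ.isClosed_closedBall R) fun y hy => ?_
  rcases le_total ‖y.log‖ 1 with h1 | h1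
  · exact Or.inl ⟨y.log, by simpa using h1, rfl⟩
  right
  have hcont : Continuous fun s : ℝ => ‖(dilation s y).log‖ :=
    (continuous_log.comp (continuous_dilation.comp (by fun_prop : Continuous fun s : ℝ => (s, y)))).norm
  obtain ⟨s, hs, hs1⟩ := intermediate_value_Icc zero_le_one hcont.continuousOn
    (show (1 : ℝ) ∈ Icc _ _ by simpa using h1)
  have hs0 : s ≠ 0 := by
    rintro rfl
    simp at hs1
  have hspos : 0 < s := lt_of_le_of_ne hs.1 hs0.symm
  have hmem : dilation s y ∈ (exp '' Metric.sphere (0 : 𝔤) 1 : Set A.StratifiedGroup) :=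
    ⟨_, mem_sphere_zero_iff_norm.2 hs1, rfl⟩
  have hle := hmin _ hmem
  rw [ρ.dist_one_dilation hspos] at hle
  have hle' : c ≤ s * R := hle.trans (mul_le_mul_of_nonneg_left hy hspos.le)
  refine ⟨(s⁻¹, dilation s y), ⟨⟨by positivity, ?_⟩, hmem⟩, ?_⟩
  · rw [inv_le_iff_one_le_mul₀' hspos, ← mul_div_assoc, le_div_iff₀ hc, one_mul]
    exact hle'
  · simp [dilation_dilation, hs0]

/-- A criterion for local Hausdorff convergence to a homogeneous set: no point outside the limit
is approached and every point of the limit is approached. -/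
theorem locallyConvergesTo_of_eventually [FiniteDimensional ℝ 𝔤] {S : ℝ → Set A.StratifiedGroup}
    {T : Set A.StratifiedGroup}
    (h_out : ∀ y, y ∉ T → ∃ U ∈ 𝓝 y, ∀ᶠ r in 𝓝[>] (0 : ℝ), ∀ z ∈ U, z ∉ S r)
    (h_in : ∀ y ∈ T, ∀ U ∈ 𝓝 y, ∀ᶠ r in 𝓝[>] (0 : ℝ), ∃ z ∈ U, z ∈ S r)
    (hT : ∀ r : ℝ, 0 < r → dilation r '' T ⊆ T) : ρ.LocallyConvergesTo S T := by
  intro R hR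
  -- If points of `T` lay in the neighborhood `U` given by `h_out`, then `h_in` would force the sets
  -- `S r` to meet `U`.
  have hTc : IsClosed T := by
    refine isOpen_compl_iff.1 (isOpen_iff_mem_nhds.2 fun y hy => ?_)
    obtain ⟨U, hU, hev⟩ := h_out y hy
    filter_upwards [eventually_mem_nhds_iff.2 hU] with z hz hzT
    obtain ⟨r, h1, w, hw, hwS⟩ := (hev.and (h_in z hzT U hz)).exists
    exact h1 w hw hwS
  have hK := ρ.isCompact_closedBall R
  refine ENNReal.tendsto_nhds_zero.2 fun ε hε => ?_
  obtain ⟨η, hη, hηε⟩ : ∃ η : ℝ, 0 < η ∧ ENNReal.ofReal η ≤ ε := by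
    by_cases h : ε = ⊤
    · exact ⟨1, one_pos, h ▸ le_top⟩
    · exact ⟨ε.toReal, ENNReal.toReal_pos hε.ne' h, ENNReal.ofReal_toReal_le⟩
  have upper : ∀ᶠ r in 𝓝[>] (0 : ℝ), ∀ z ∈ S r ∩ ρ.closedBall R,
      ∃ t ∈ T ∩ ρ.closedBall R, ρ.dist z t ≤ η := by
    -- The points of the ball at distance at least `η` from the limit form a compact set disjoint
    -- from `T`; finitely many neighborhoods from `h_out` cover it.
    have hC : IsCompact (ρ.closedBall R ∩ {y | ∀ t ∈ T ∩ ρ.closedBall R, η ≤ ρ.dist y t}) := by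
      refine hK.inter_right ?_
      simp only [ofPred_forall]
      exact isClosed_biInter fun t _ => isClosed_le continuous_const (ρ.continuous_dist_left t)
    have hev : ∀ᶠ r in 𝓝[>] (0 : ℝ),
        ∀ z ∈ ρ.closedBall R ∩ {y | ∀ t ∈ T ∩ ρ.closedBall R, η ≤ ρ.dist y t}, z ∉ S r := by
      refine hC.induction_on (p := fun U => ∀ᶠ r in 𝓝[>] (0 : ℝ), ∀ z ∈ U, z ∉ S r) ?_ ?_ ?_ ?_
      · simp
      · exact fun s t hst h => h.mono fun r hr z hz => hr z (hst hz)
      · exact fun s t hs ht => (hs.and ht).mono fun r hr z hz => hz.elim (hr.1 z) (hr.2 z)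
      · intro y hy
        have hyT : y ∉ T := fun h => by
          have := hy.2 y ⟨h, hy.1⟩
          rw [ρ.dist_self] at this
          linarith
        obtain ⟨U, hU, h⟩ := h_out y hyT
        exact ⟨U, mem_nhdsWithin_of_mem_nhds hU, h⟩
    filter_upwards [hev] with r hr z hz
    by_contra! hcon
    exact hr z ⟨hz.2, fun t ht => (hcon t ht).le⟩ hz.1
  have lower : ∀ᶠ r in 𝓝[>] (0 : ℝ), ∀ t ∈ T ∩ ρ.closedBall R,
      ∃ z ∈ S r ∩ ρ.closedBall R, ρ.dist t z ≤ η := by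
    refine (hK.inter_left hTc).induction_on (p := fun U => ∀ᶠ r in 𝓝[>] (0 : ℝ), ∀ t ∈ U,
      ∃ z ∈ S r ∩ ρ.closedBall R, ρ.dist t z ≤ η) ?_ ?_ ?_ ?_
    · simp
    · exact fun s t hst h => h.mono fun r hr z hz => hr z (hst hz)
    · exact fun s t hs ht => (hs.and ht).mono fun r hr z hz => hz.elim (hr.1 z) (hr.2 z)
    · rintro y ⟨hyT, hyR⟩
      -- If `y` is on the boundary of the ball, its approximants may lie outside. The point `δ_s y`
      -- with `s < 1` close to one still belongs to `T` and is strictly inside, so its approximants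
      -- are admissible. The errors add up to `η/4 + η/2 + η/4`.
      have hlim : Tendsto (fun s : ℝ => ρ.dist y (dilation s y)) (𝓝[<] 1) (𝓝 0) := by
        have hc : Continuous fun s : ℝ => ρ.dist y (dilation s y) :=
          (ρ.continuous_dist_right y).comp
            (continuous_dilation.comp (by fun_prop : Continuous fun s : ℝ => (s, y)))
        have := hc.tendsto 1
        simp only [dilation_one_left, ρ.dist_self] at this
        exact this.mono_left nhdsWithin_le_nhds
      obtain ⟨s, hsη, hs1, hs0⟩ := ((hlim.eventually_lt_const (half_pos hη)).and
        (eventually_mem_nhdsWithin.and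
          (eventually_nhdsWithin_of_eventually_nhds (eventually_gt_nhds one_pos)))).exists
      have hs1 : s < 1 := hs1
      have hlt : ρ.dist 1 (dilation s y) < R := by
        rw [ρ.dist_one_dilation hs0]
        have hyR' : ρ.dist 1 y ≤ R := hyR
        nlinarith
      have hU : {z | ρ.dist 1 z < R ∧ ρ.dist (dilation s y) z < η / 4} ∈ 𝓝 (dilation s y) := by
        refine IsOpen.mem_nhds ((isOpen_lt (ρ.continuous_dist_right _) continuous_const).inter
          (isOpen_lt (ρ.continuous_dist_right _) continuous_const)) ⟨hlt, ?_⟩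
        rw [ρ.dist_self]
        positivity
      have hN : {t | ρ.dist t y < η / 4} ∈ 𝓝 y := by
        refine (isOpen_lt (ρ.continuous_dist_left _) continuous_const).mem_nhds ?_
        change ρ.dist _ _ < _
        rw [ρ.dist_self]
        positivity
      refine ⟨_, mem_nhdsWithin_of_mem_nhds hN, ?_⟩
      filter_upwards [h_in _ (hT s hs0 ⟨y, hyT, rfl⟩) _ hU] with r ⟨z, ⟨hz1, hz2⟩, hzS⟩ t ht
      have ht : ρ.dist t y < η / 4 := ht
      refine ⟨z, ⟨hzS, hz1.le⟩, ?_⟩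
      linarith [ρ.dist_triangle t y z, ρ.dist_triangle y (dilation s y) z]
  filter_upwards [upper, lower] with r hu hl
  refine le_trans ?_ hηε
  let _ := ρ.toMetricSpace
  refine Metric.hausdorffEDist_le_of_mem_edist (fun z hz => ?_) (fun t ht => ?_)
  · obtain ⟨t, ht, h⟩ := hu z hz
    exact ⟨t, ht, by rw [edist_dist]; exact ENNReal.ofReal_le_ofReal h⟩
  · obtain ⟨z, hz, h⟩ := hl t ht
    exact ⟨z, hz, by rw [edist_dist]; exact ENNReal.ofReal_le_ofReal h⟩

end HomogeneousDistance
end StratifiedGroup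
end TwoStepStratifiedAlgebra

/-! ### Convergence of the rescaled sets to the blow-up -/

namespace TwoStepStratifiedAlgebra

variable {𝔤 : Type*} [NormedAddCommGroup 𝔤] [InnerProductSpace ℝ 𝔤]
  {A : TwoStepStratifiedAlgebra 𝔤}

namespace StratifiedGroup

theorem tendsto_log_mul_left [FiniteDimensional ℝ 𝔤] (x : A.StratifiedGroup) :
    Tendsto (fun w : 𝔤 => x * exp w) (𝓝 0) (𝓝 x) := by
  have hc : Continuous fun w : 𝔤 => x * (exp w : A.StratifiedGroup) :=
    (contMDiff_mul_left (I := 𝓘(ℝ, 𝔤)) (n := ω)).continuous.comp continuous_exp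
  have := hc.tendsto 0
  rwa [show x * (exp 0 : A.StratifiedGroup) = x from mul_one x] at this

/-- In exponential coordinates centered at one of its points, a `C²` submanifold is locally the
zero set of a `C²` map with surjective differential. -/
theorem IsC2Submanifold.exists_local_equation [FiniteDimensional ℝ 𝔤] {p : ℕ}
    {S : Set A.StratifiedGroup} (hS : IsC2Submanifold p S) {x : A.StratifiedGroup} (hx : x ∈ S) :
    ∃ k : ℕ, p + k = Module.finrank ℝ 𝔤 ∧ ∃ g : 𝔤 → EuclideanSpace ℝ (Fin k),
      ContDiffAt ℝ 2 g 0 ∧ g 0 = 0 ∧ Function.Surjective (fderiv ℝ g 0) ∧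
      ∀ᶠ w in 𝓝 0, (x * exp w ∈ S ↔ g w = 0) := by
  obtain ⟨k, hk, h⟩ := hS
  obtain ⟨V, hV, hxV, f, hf, hSV, hsurj⟩ := h x hx
  refine ⟨k, hk, fun w => f (x * exp w), ?_⟩
  have hmul : ContMDiff 𝓘(ℝ, 𝔤) 𝓘(ℝ, 𝔤) 2 fun w : 𝔤 => x * (exp w : A.StratifiedGroup) :=
    ((contMDiff_mul_left (I := 𝓘(ℝ, 𝔤)) (n := ω)).comp contMDiff_exp).of_le le_top
  have hx1 : x * (exp 0 : A.StratifiedGroup) = x := mul_one x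
  have hfx : ContMDiffAt 𝓘(ℝ, 𝔤) 𝓘(ℝ, EuclideanSpace ℝ (Fin k)) 2 f x :=
    hf.contMDiffAt (hV.mem_nhds hxV)
  have hg : ContDiffAt ℝ 2 (fun w : 𝔤 => f (x * exp w)) 0 := by
    refine contMDiffAt_iff_contDiffAt.1 (ContMDiffAt.comp (I' := 𝓘(ℝ, 𝔤)) (0 : 𝔤) (g := f) ?_
      hmul.contMDiffAt)
    rwa [hx1]
  have hmem : ∀ y ∈ V, (y ∈ S ↔ f y = 0) := fun y hy => by
    have : y ∈ S ∩ V ↔ y ∈ {s ∈ V | f s = 0} := by rw [hSV]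
    simpa [hy] using this
  refine ⟨hg, ?_, ?_, ?_⟩
  · change f (x * exp 0) = 0
    rw [hx1]
    exact (hmem x hxV).1 hx
  -- As `f = g ∘ log (x⁻¹ ·)`, the chain rule factors the surjective differential of `f` at `x`
  -- through that of `g` at `0`.
  · have hlog : ContMDiff 𝓘(ℝ, 𝔤) 𝓘(ℝ, 𝔤) 2 fun y : A.StratifiedGroup => (x⁻¹ * y).log :=
      (contMDiff_log.comp (contMDiff_mul_left (I := 𝓘(ℝ, 𝔤)) (n := ω))).of_le le_top
    have hx0 : (x⁻¹ * x).log = 0 := by rw [inv_mul_cancel, log_one]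
    have hgd : MDifferentiableAt 𝓘(ℝ, 𝔤) 𝓘(ℝ, EuclideanSpace ℝ (Fin k))
        (fun w : 𝔤 => f (x * exp w)) (x⁻¹ * x).log := by
      rw [hx0]
      exact (hg.differentiableAt (by simp)).mdifferentiableAt
    have hcomp := mfderiv_comp x hgd (hlog.mdifferentiable (by simp) x)
    have hfun : (fun w : 𝔤 => f (x * exp w)) ∘ (fun y : A.StratifiedGroup => (x⁻¹ * y).log) = f := by
      funext y
      exact congrArg f (mul_inv_cancel_left x y)
    rw [hfun, mfderiv_eq_fderiv] at hcomp
    have hs := hsurj x ⟨hx, hxV⟩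
    rw [hcomp, hx0] at hs
    intro v
    obtain ⟨u, hu⟩ := hs v
    exact ⟨_, hu⟩
  · filter_upwards [(tendsto_log_mul_left x).eventually (hV.mem_nhds hxV)] with w hw
    exact hmem _ hw

variable {F : Type*} [NormedAddCommGroup F] [NormedSpace ℝ F]

/-- The homogeneous tangent set, at the unit element, of the zero set of a map with differential
`L` and second differential `B`. -/
def blowUp (A : TwoStepStratifiedAlgebra 𝔤) (L : 𝔤 →L[ℝ] F) (B : 𝔤 →L[ℝ] 𝔤 →L[ℝ] F) :
    Set A.StratifiedGroup :=
  {z | L (A.proj₁ z.log) = 0 ∧ L (A.proj₂ z.log) + (1 / 2 : ℝ) • B (A.proj₁ z.log) (A.proj₁ z.log) ∈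
    A.V₁.map (L : 𝔤 →ₗ[ℝ] F)}

/-- The two conditions are homogeneous of degrees one and two, and `L(V₁)` is a subspace. -/
theorem dilation_image_blowUp_subset (L : 𝔤 →L[ℝ] F) (B : 𝔤 →L[ℝ] 𝔤 →L[ℝ] F) (r : ℝ) :
    dilation r '' blowUp A L B ⊆ blowUp A L B := by
  rintro _ ⟨z, ⟨h1, h2⟩, rfl⟩
  constructor
  · rw [proj₁_log_dilation, map_smul, h1, smul_zero]
  · rw [proj₁_log_dilation, proj₂_log_dilation]
    convert Submodule.smul_mem _ (r ^ 2) h2 using 1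
    rw [map_smul B, smul_apply, map_smul, map_smul, smul_add, smul_comm (r ^ 2) (1 / 2 : ℝ),
      sq, ← smul_smul r r (B _ _)]

/-- Limit points of the rescaled sets lie in the blow-up. -/
theorem mem_blowUp_of_frequently_mem_rescale [FiniteDimensional ℝ 𝔤] [FiniteDimensional ℝ F]
    {S : Set A.StratifiedGroup} {x : A.StratifiedGroup} {g : 𝔤 → F} {L : 𝔤 →L[ℝ] F}
    {B : 𝔤 →L[ℝ] 𝔤 →L[ℝ] F}
    (hg : (fun w => g w - L w - (1 / 2 : ℝ) • B w w) =o[𝓝 0] fun w => ‖w‖ ^ 2)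
    (hS : ∀ᶠ w in 𝓝 0, (x * exp w ∈ S ↔ g w = 0)) {α : Type*} {l : Filter α} {r : α → ℝ}
    {z : α → A.StratifiedGroup} {y : A.StratifiedGroup} (hr : Tendsto r l (𝓝 0))
    (hr0 : ∀ᶠ t in l, r t ≠ 0) (hz : Tendsto z l (𝓝 y))
    (hfreq : ∃ᶠ t in l, z t ∈ rescale S x (r t)) : y ∈ blowUp A L B := by
  have c1 : Continuous A.proj₁ := A.proj₁.continuous_of_finiteDimensional
  have c2 : Continuous A.proj₂ := A.proj₂.continuous_of_finiteDimensional
  have ha : Tendsto (fun t => A.proj₁ (z t).log) l (𝓝 (A.proj₁ y.log)) :=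
    ((c1.comp continuous_log).tendsto y).comp hz
  have hb : Tendsto (fun t => A.proj₂ (z t).log) l (𝓝 (A.proj₂ y.log)) :=
    ((c2.comp continuous_log).tendsto y).comp hz
  have hΨ := tendsto_anisotropic_taylor hg hr hr0 ha hb
  have hw : Tendsto (fun t => r t • A.proj₁ (z t).log + r t ^ 2 • A.proj₂ (z t).log) l (𝓝 0) := by
    simpa using (hr.smul ha).add ((hr.pow 2).smul hb)
  have hfreq' : ∃ᶠ t in l, r t ≠ 0 ∧
      g (r t • A.proj₁ (z t).log + r t ^ 2 • A.proj₂ (z t).log) = 0 := by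
    refine (hfreq.and_eventually (hr0.and (hw.eventually hS))).mono fun t ht => ⟨ht.2.1, ?_⟩
    exact ht.2.2.1 ((mem_rescale_iff ht.2.1).1 ht.1)
  constructor
  -- Multiplied by `r`, the bounded expansion tends to zero; adding `L a` gives an expression that
  -- is exactly zero whenever `g` vanishes.
  · have hlim : Tendsto (fun t => r t • ((r t ^ 2)⁻¹ •
        g (r t • A.proj₁ (z t).log + r t ^ 2 • A.proj₂ (z t).log) - (r t)⁻¹ • L (A.proj₁ (z t).log))
        + L (A.proj₁ (z t).log)) l (𝓝 (L (A.proj₁ y.log))) := by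
      have := (hr.smul hΨ).add ((L.continuous.tendsto _).comp ha)
      rwa [zero_smul, zero_add] at this
    refine isClosed_singleton.mem_of_frequently_of_tendsto (s := {(0 : F)})
      (hfreq'.mono fun t ht => ?_) hlim
    simp [ht.2, ht.1]
  -- At zeros of `g` the expansion equals `-r⁻¹ L a`, an element of the closed subspace `L(V₁)`.
  · refine (Submodule.closed_of_finiteDimensional _).mem_of_frequently_of_tendsto
      (hfreq'.mono fun t ht => ?_) hΨ
    rw [ht.2, smul_zero, zero_sub]
    exact neg_mem (Submodule.smul_mem _ _ (Submodule.mem_map_of_mem (A.proj₁_mem _)))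

/-- The limit point lemma is applied to the product filter `𝓝[>] 0 ×ˢ 𝓝 y`, which makes the
exclusion uniform on a neighborhood of `y`. -/
theorem eventually_notMem_rescale [FiniteDimensional ℝ 𝔤] [FiniteDimensional ℝ F]
    {S : Set A.StratifiedGroup} {x : A.StratifiedGroup} {g : 𝔤 → F} {L : 𝔤 →L[ℝ] F}
    {B : 𝔤 →L[ℝ] 𝔤 →L[ℝ] F}
    (hg : (fun w => g w - L w - (1 / 2 : ℝ) • B w w) =o[𝓝 0] fun w => ‖w‖ ^ 2)
    (hS : ∀ᶠ w in 𝓝 0, (x * exp w ∈ S ↔ g w = 0)) {y : A.StratifiedGroup}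
    (hy : y ∉ blowUp A L B) :
    ∃ U ∈ 𝓝 y, ∀ᶠ r in 𝓝[>] (0 : ℝ), ∀ z ∈ U, z ∉ rescale S x r := by
  have hr : Tendsto (Prod.fst : ℝ × A.StratifiedGroup → ℝ) (𝓝[>] 0 ×ˢ 𝓝 y) (𝓝[>] 0) :=
    tendsto_fst
  have hpos : ∀ᶠ r in 𝓝[>] (0 : ℝ), r ≠ 0 := eventually_mem_nhdsWithin.mono fun r hr => ne_of_gt hr
  have h : ∀ᶠ q in 𝓝[>] (0 : ℝ) ×ˢ 𝓝 y, q.2 ∉ rescale S x q.1 := by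
    by_contra hcon
    exact hy (mem_blowUp_of_frequently_mem_rescale hg hS (hr.mono_right nhdsWithin_le_nhds)
      (hr.eventually hpos) tendsto_snd fun h => hcon h)
  obtain ⟨pa, ha, pb, hb, hab⟩ := eventually_prod_iff.1 h
  exact ⟨{z | pb z}, hb, ha.mono fun r hr z hz => hab hr hz⟩

/-- An approximate zero `w r` with `g (w r) = o(r²)` is corrected by metric regularity to an exact
zero `w r + e r` with `e r = o(r²)`. After `δ_{1/r}` the error has components of order `r⁻¹ e` and
`r⁻² e`, both vanishing in the limit. -/
theorem eventually_exists_mem_rescale [FiniteDimensional ℝ 𝔤] [CompleteSpace F]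
    {S : Set A.StratifiedGroup} {x : A.StratifiedGroup} {g : 𝔤 → F} {L : 𝔤 →L[ℝ] F}
    {B : 𝔤 →L[ℝ] 𝔤 →L[ℝ] F}
    (hg : (fun w => g w - L w - (1 / 2 : ℝ) • B w w) =o[𝓝 0] fun w => ‖w‖ ^ 2)
    (hgL : HasStrictFDerivAt g L 0) (hL : Function.Surjective L) (hg0 : g 0 = 0)
    (hS : ∀ᶠ w in 𝓝 0, (x * exp w ∈ S ↔ g w = 0)) {y : A.StratifiedGroup}
    (hy : y ∈ blowUp A L B) {U : Set A.StratifiedGroup} (hU : U ∈ 𝓝 y) :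
    ∀ᶠ r in 𝓝[>] (0 : ℝ), ∃ z ∈ U, z ∈ rescale S x r := by
  have c1 : Continuous A.proj₁ := A.proj₁.continuous_of_finiteDimensional
  have c2 : Continuous A.proj₂ := A.proj₂.continuous_of_finiteDimensional
  obtain ⟨C, hC, hreg⟩ := hgL.exists_zero_of_surjective hL hg0
  obtain ⟨hy1, u, hu, hLu⟩ := hy
  have hLu : L u = L (A.proj₂ y.log) + (1 / 2 : ℝ) • B (A.proj₁ y.log) (A.proj₁ y.log) := hLu
  set a := A.proj₁ y.log with ha
  -- Subtracting `u` cancels the limit of the Taylor expansion. Since `u ∈ V₁`, the term `-r² u`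
  -- becomes `-r u` after `δ_{1/r}` and disappears.
  set b := A.proj₂ y.log - u with hb
  set l := 𝓝[>] (0 : ℝ) with hl
  have hr : Tendsto (fun r : ℝ => r) l (𝓝 0) := nhdsWithin_le_nhds
  have hr0 : ∀ᶠ r in l, r ≠ 0 := eventually_mem_nhdsWithin.mono fun r hr => (ne_of_gt hr)
  set w : ℝ → 𝔤 := fun r => r • a + r ^ 2 • b with hw
  have hw0 : Tendsto w l (𝓝 0) := by
    simpa using (hr.smul_const a).add ((hr.pow 2).smul_const b)
  have hgw : Tendsto (fun r => (r ^ 2)⁻¹ • g (w r)) l (𝓝 0) := by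
    have := tendsto_anisotropic_taylor hg hr hr0 (tendsto_const_nhds (x := a))
      (tendsto_const_nhds (x := b))
    simpa [hy1, hb, hLu] using this
  have hex : ∀ᶠ r in l, ∃ e : 𝔤, g (w r + e) = 0 ∧ ‖e‖ ≤ C * ‖g (w r)‖ := by
    filter_upwards [hw0.eventually hreg] with r ⟨w', h1, h2⟩
    exact ⟨w' - w r, by simpa using h1, h2⟩
  obtain ⟨e, he⟩ := hex.choice
  have he2 : Tendsto (fun r => (r ^ 2)⁻¹ • e r) l (𝓝 0) := by
    refine squeeze_zero_norm' (a := fun r => C * ‖(r ^ 2)⁻¹ • g (w r)‖) ?_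
      (by simpa using hgw.norm.const_mul C)
    filter_upwards [he] with r hr
    rw [norm_smul, norm_smul, mul_left_comm]
    exact mul_le_mul_of_nonneg_left hr.2 (norm_nonneg _)
  have he1 : Tendsto (fun r => r⁻¹ • e r) l (𝓝 0) := by
    have := hr.smul he2
    rw [smul_zero] at this
    refine this.congr' ?_
    filter_upwards [hr0] with r h
    rw [smul_smul]
    congr 1
    field_simp
  have he0 : Tendsto e l (𝓝 0) := by
    have := hr.smul he1
    rw [smul_zero] at this
    refine this.congr' ?_
    filter_upwards [hr0] with r h
    rw [smul_smul, mul_inv_cancel₀ h, one_smul]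
  -- This is `δ_{1/r}` of the exact zero `w r + e r`, written out layer by layer.
  have hlim : Tendsto (fun r => (exp (a + A.proj₂ y.log - r • u + A.proj₁ (r⁻¹ • e r)
      + A.proj₂ ((r ^ 2)⁻¹ • e r)) : A.StratifiedGroup)) l (𝓝 y) := by
    have h1 : Tendsto (fun r => a + A.proj₂ y.log - r • u + A.proj₁ (r⁻¹ • e r)
      + A.proj₂ ((r ^ 2)⁻¹ • e r)) l (𝓝 y.log) := by
      have := ((tendsto_const_nhds (x := a + A.proj₂ y.log) (f := l)).sub (hr.smul_const u)).add
        ((c1.tendsto _).comp he1) |>.add ((c2.tendsto _).comp he2)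
      simpa [ha, A.proj₁_add_proj₂] using this
    exact (continuous_exp.tendsto y.log).comp h1
  have hwe : Tendsto (fun r => w r + e r) l (𝓝 0) := by simpa using hw0.add he0
  filter_upwards [hlim.eventually hU, hr0, hwe.eventually hS, he] with r h1 h2 h3 h4
  refine ⟨_, h1, (mem_rescale_iff h2).2 ?_⟩
  convert h3.2 h4.1 using 2
  ext
  rw [log_dilation]
  have e1 : r * r⁻¹ = 1 := mul_inv_cancel₀ h2
  have e3 : r * r = r ^ 2 := (sq r).symm
  have e2 : r ^ 2 * (r ^ 2)⁻¹ = 1 := mul_inv_cancel₀ (pow_ne_zero 2 h2)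
  have hdec := A.proj₁_add_proj₂ (e r)
  simp only [map_add, map_sub, map_smul, proj₁_proj₁, proj₁_proj₂, proj₂_proj₁, proj₂_proj₂,
    A.proj₁_of_mem_V₁ hu, A.proj₂_of_mem_V₁ hu, ha, smul_add, smul_sub, smul_smul, e1, e2, e3, hw, hb,
    smul_zero, one_smul]
  nth_rewrite 3 [← hdec]
  abel

/-- The rescalings of a set with a regular `C²` local equation converge to its blow-up. -/
theorem HomogeneousDistance.locallyConvergesTo_blowUp [FiniteDimensional ℝ 𝔤]
    [FiniteDimensional ℝ F] (ρ : HomogeneousDistance A)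
    {S : Set A.StratifiedGroup} {x : A.StratifiedGroup} {g : 𝔤 → F} (hg : ContDiffAt ℝ 2 g 0)
    (hg0 : g 0 = 0) (hL : Function.Surjective (fderiv ℝ g 0))
    (hS : ∀ᶠ w in 𝓝 0, (x * exp w ∈ S ↔ g w = 0)) :
    ρ.LocallyConvergesTo (rescale S x) (blowUp A (fderiv ℝ g 0) (fderiv ℝ (fderiv ℝ g) 0)) := by
  have : CompleteSpace F := FiniteDimensional.complete ℝ F
  have ht := hg.isLittleO_taylor_two
  simp only [zero_add, hg0, sub_zero] at ht
  exact ρ.locallyConvergesTo_of_eventually (fun y hy => eventually_notMem_rescale ht hS hy)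
    (fun y hy U hU => eventually_exists_mem_rescale ht (hg.hasStrictFDerivAt (by simp)) hL hg0 hS hy hU)
    fun r _ => dilation_image_blowUp_subset _ _ r

end StratifiedGroup
end TwoStepStratifiedAlgebra

/-! ### The blow-up as a homogeneous polynomial graph -/

namespace TwoStepStratifiedAlgebra

variable {𝔤 : Type*} [NormedAddCommGroup 𝔤] [InnerProductSpace ℝ 𝔤]
  {A : TwoStepStratifiedAlgebra 𝔤}

namespace StratifiedGroup

/-- The graded basis made of orthonormal bases of the two layers. -/
noncomputable def GradedBasis.ofLayers
    (b₁ : OrthonormalBasis (Fin (Module.finrank ℝ A.V₁)) ℝ A.V₁)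
    (b₂ : OrthonormalBasis (Fin (Module.finrank ℝ A.V₂)) ℝ A.V₂) : GradedBasis A :=
  have hon : Orthonormal ℝ
      (Sum.elim (fun i => (b₁ i : 𝔤)) (fun i => (b₂ i : 𝔤)) : CoordIndex A → 𝔤) := by
    have h1 := orthonormal_iff_ite.1 b₁.orthonormal
    have h2 := orthonormal_iff_ite.1 b₂.orthonormal
    rw [orthonormal_iff_ite]
    rintro (i | i) (j | j)
    · simpa using h1 i j
    · simpa using A.orthogonal _ (b₁ i).2 _ (b₂ j).2
    · simpa [real_inner_comm] using A.orthogonal _ (b₁ j).2 _ (b₂ i).2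
    · simpa using h2 i j
  have hspan : ⊤ ≤ Submodule.span ℝ (range
      (Sum.elim (fun i => (b₁ i : 𝔤)) (fun i => (b₂ i : 𝔤)) : CoordIndex A → 𝔤)) := by
    have e1 : (range fun i => (b₁ i : 𝔤)) = A.V₁.subtype '' range b₁.toBasis := by
      rw [← range_comp]
      simp [Function.comp_def]
    have e2 : (range fun i => (b₂ i : 𝔤)) = A.V₂.subtype '' range b₂.toBasis := by
      rw [← range_comp]
      simp [Function.comp_def]
    rw [Sum.elim_range, Submodule.span_union, e1, e2, Submodule.span_image, Submodule.span_image,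
      b₁.toBasis.span_eq, b₂.toBasis.span_eq, Submodule.map_subtype_top, Submodule.map_subtype_top,
      A.isCompl.sup_eq_top]
  { basis := OrthonormalBasis.mk hon hspan
    mem_V₁ := fun i => by simp
    mem_V₂ := fun i => by simp }

theorem GradedBasis.ofLayers_inl (b₁ : OrthonormalBasis (Fin (Module.finrank ℝ A.V₁)) ℝ A.V₁)
    (b₂ : OrthonormalBasis (Fin (Module.finrank ℝ A.V₂)) ℝ A.V₂) (i : Fin _) :
    (GradedBasis.ofLayers b₁ b₂).basis (Sum.inl i) = b₁ i := by
  simp [ofLayers]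

theorem GradedBasis.ofLayers_inr (b₁ : OrthonormalBasis (Fin (Module.finrank ℝ A.V₁)) ℝ A.V₁)
    (b₂ : OrthonormalBasis (Fin (Module.finrank ℝ A.V₂)) ℝ A.V₂) (i : Fin _) :
    (GradedBasis.ofLayers b₁ b₂).basis (Sum.inr i) = b₂ i := by
  simp [ofLayers]

theorem GradedBasis.inner_basis_log_coords (W : GradedBasis A) (y : CoordIndex A → ℝ)
    (i : CoordIndex A) : inner ℝ (W.basis i) (W.coords y).log = y i := by
  have := orthonormal_iff_ite.1 W.basis.orthonormal
  simp only [coords, inner_sum, inner_smul_right, this]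
  simp

theorem GradedBasis.coords_surjective (W : GradedBasis A) : Function.Surjective W.coords :=
  fun z => ⟨W.basis.repr z.log, by ext; exact W.basis.sum_repr z.log⟩

theorem GradedBasis.inner_inl_proj₁ (W : GradedBasis A) (i : Fin (Module.finrank ℝ A.V₁)) (v : 𝔤) :
    inner ℝ (W.basis (Sum.inl i)) (A.proj₁ v) = inner ℝ (W.basis (Sum.inl i)) v := by
  conv_rhs => rw [← A.proj₁_add_proj₂ v, inner_add_right,
    A.orthogonal _ (W.mem_V₁ i) _ (A.proj₂_mem v), add_zero]

theorem GradedBasis.inner_inr_proj₂ (W : GradedBasis A) (i : Fin (Module.finrank ℝ A.V₂)) (v : 𝔤) :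
    inner ℝ (W.basis (Sum.inr i)) (A.proj₂ v) = inner ℝ (W.basis (Sum.inr i)) v := by
  conv_rhs => rw [← A.proj₁_add_proj₂ v, inner_add_right, real_inner_comm,
    A.orthogonal _ (A.proj₁_mem v) _ (W.mem_V₂ i), zero_add]

/-- The codimension of the blow-up, as a sum of the contributions of the two layers. -/
theorem finrank_ker_add_finrank_ker [FiniteDimensional ℝ 𝔤] {F : Type*} [AddCommGroup F]
    [Module ℝ F] [FiniteDimensional ℝ F] {L : 𝔤 →ₗ[ℝ] F} (hL : Function.Surjective L) :
    Module.finrank ℝ (L ∘ₗ A.V₁.subtype).ker +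
      Module.finrank ℝ ((A.V₁.map L).mkQ ∘ₗ L ∘ₗ A.V₂.subtype).ker + Module.finrank ℝ F
      = Module.finrank ℝ A.V₁ + Module.finrank ℝ A.V₂ := by
  have h1 := (L ∘ₗ A.V₁.subtype).finrank_range_add_finrank_ker
  have h2 := ((A.V₁.map L).mkQ ∘ₗ L ∘ₗ A.V₂.subtype).finrank_range_add_finrank_ker
  rw [LinearMap.range_comp, Submodule.range_subtype] at h1
  -- Modulo `L(V₁)`, the vector `L v` depends only on the second layer component of `v`.
  have htop : ((A.V₁.map L).mkQ ∘ₗ L ∘ₗ A.V₂.subtype).range = ⊤ := by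
    rw [LinearMap.range_eq_top]
    intro q
    obtain ⟨w, rfl⟩ := Submodule.mkQ_surjective _ q
    obtain ⟨v, rfl⟩ := hL w
    refine ⟨⟨A.proj₂ v, A.proj₂_mem v⟩, ?_⟩
    refine (Submodule.Quotient.eq _).2 ?_
    refine ⟨-A.proj₁ v, neg_mem (A.proj₁_mem v), ?_⟩
    conv_rhs => rw [← A.proj₁_add_proj₂ v]
    simp
  rw [htop, finrank_top] at h2
  have h3 := (A.V₁.map L).finrank_quotient_add_finrank
  omega

open MvPolynomial in
/-- The blow-up is a graph over graded coordinates adapted to the differential: the dependent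
coordinates vanish in the first layer and are quadratic polynomials in the second layer. -/
theorem isHomogeneousPolynomialGraph_blowUp [FiniteDimensional ℝ 𝔤] {F : Type*}
    [NormedAddCommGroup F] [NormedSpace ℝ F] [FiniteDimensional ℝ F] {p : ℕ}
    (hp : p + Module.finrank ℝ F = Module.finrank ℝ 𝔤) {L : 𝔤 →L[ℝ] F}
    (hL : Function.Surjective L) (B : 𝔤 →L[ℝ] 𝔤 →L[ℝ] F) :
    IsHomogeneousPolynomialGraph p (blowUp A L B) := by
  classical
  let Λ : 𝔤 →ₗ[ℝ] F := L.toLinearMap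
  set E := A.V₁.map Λ with hE
  obtain ⟨b₁, J₁, hJ₁, hN₁⟩ := (Λ ∘ₗ A.V₁.subtype).ker.exists_orthonormalBasis_adapted
  obtain ⟨b₂, J₂, hJ₂, hN₂⟩ := (E.mkQ ∘ₗ Λ ∘ₗ A.V₂.subtype).ker.exists_orthonormalBasis_adapted
  have hdim := finrank_ker_add_finrank_ker (A := A) (L := Λ) hL
  rw [← hE] at hdim
  have hsum := Submodule.finrank_add_eq_of_isCompl A.isCompl
  obtain ⟨R, hR⟩ := Λ.exists_rightInverse_of_surjective (LinearMap.range_eq_top.2 hL)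
  set W := GradedBasis.ofLayers b₁ b₂ with hW
  -- The map `s` into `V₂` is a right inverse of `L` modulo `E`, so `L b + t ∈ E` amounts to `b + s
  -- t` lying in the kernel of `V₂ → F / E`: coordinatewise, `b_j = -⟨W_j, s t⟩` for `j ∈ J₂`.
  set s : F →ₗ[ℝ] 𝔤 := A.proj₂ ∘ₗ R with hs
  have hsE : ∀ t, t - Λ (s t) ∈ E := fun t => by
    refine ⟨A.proj₁ (R t), A.proj₁_mem _, ?_⟩
    have h1 : Λ (R t) = t := LinearMap.congr_fun hR t
    have h2 := congrArg Λ (A.proj₁_add_proj₂ (R t))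
    rw [map_add, h1] at h2
    exact eq_sub_of_add_eq h2
  set J : Finset (CoordIndex A) := J₁.disjSum J₂ with hJ
  let c : CoordIndex A → CoordIndex A → CoordIndex A → ℝ := fun j i i' =>
    -(1 / 2) * inner ℝ (W.basis j) (s (B (A.proj₁ (W.basis i)) (A.proj₁ (W.basis i'))))
  -- Only pairs of first layer variables contribute, so `Q` has weighted degree two although its sum
  -- runs over all free variables.
  have hc : ∀ j i i', coordDegree i + coordDegree i' ≠ 2 → c j i i' = 0 := by
    rintro j (i | i) (i' | i') h
    · exact absurd rfl h
    · simp [c, A.proj₁_of_mem_V₂ (W.mem_V₂ i')]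
    · simp [c, A.proj₁_of_mem_V₂ (W.mem_V₂ i)]
    · simp [c, A.proj₁_of_mem_V₂ (W.mem_V₂ i)]
  let Q : {j // j ∈ J} → MvPolynomial {i // i ∉ J} ℝ := fun j =>
    Sum.elim (fun _ => 0) (fun j₂ => ∑ i, ∑ i', C (c (Sum.inr j₂) i.1 i'.1) * (X i * X i')) j.1
  refine ⟨W, J, Q, ?_, ?_, ?_⟩
  · rw [hJ, Finset.card_disjSum, Fintype.card_sum, Fintype.card_fin, Fintype.card_fin]
    omega
  · rintro ⟨j | j, hj⟩
    · exact isWeightedHomogeneous_zero _ _ _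
    · refine IsWeightedHomogeneous.sum _ _ _ fun i _ => IsWeightedHomogeneous.sum _ _ _ fun i' _ => ?_
      by_cases h : coordDegree i.1 + coordDegree i'.1 = 2
      · have := (isWeightedHomogeneous_C (fun i : {i // i ∉ J} => coordDegree i.1)
          (c (Sum.inr j) i.1 i'.1)).mul ((isWeightedHomogeneous_X ℝ
            (fun i : {i // i ∉ J} => coordDegree i.1) i).mul (isWeightedHomogeneous_X ℝ _ i'))
        rw [zero_add, h] at this
        exact this
      · rw [hc _ _ _ h, C_0, zero_mul]
        exact isWeightedHomogeneous_zero _ _ _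
  have key : ∀ y, W.coords y ∈ blowUp A L B ↔
      ∀ j : {j // j ∈ J}, y j.1 = eval (fun i => y i.1) (Q j) := by
    intro y
    set v := (W.coords y).log with hv
    have hcoord := W.inner_basis_log_coords y
    have h1 : Λ (A.proj₁ v) = 0 ↔ ∀ j ∈ J₁, y (Sum.inl j) = 0 := by
      refine (hN₁ ⟨A.proj₁ v, A.proj₁_mem v⟩).trans (forall₂_congr fun j _ => ?_)
      rw [Submodule.coe_inner, ← GradedBasis.ofLayers_inl b₁ b₂, ← hW, W.inner_inl_proj₁, hcoord]
    set t := (1 / 2 : ℝ) • B (A.proj₁ v) (A.proj₁ v) with ht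
    have h2 : Λ (A.proj₂ v) + t ∈ E ↔
        ∀ j ∈ J₂, y (Sum.inr j) = -inner ℝ (W.basis (Sum.inr j)) (s t) := by
      have e : Λ (A.proj₂ v) + t = Λ (A.proj₂ v + s t) + (t - Λ (s t)) := by
        rw [map_add]
        abel
      have hmem : A.proj₂ v + s t ∈ A.V₂ := add_mem (A.proj₂_mem _) (A.proj₂_mem _)
      rw [e, Submodule.add_mem_iff_left _ (hsE t)]
      refine Iff.trans ?_ ((hN₂ ⟨_, hmem⟩).trans (forall₂_congr fun j _ => ?_))
      · rw [LinearMap.mem_ker]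
        exact (Submodule.Quotient.mk_eq_zero E).symm
      · rw [Submodule.coe_inner, ← GradedBasis.ofLayers_inr b₁ b₂, inner_add_right, ← hW,
          W.inner_inr_proj₂, hcoord, add_eq_zero_iff_eq_neg]
    -- Dependent coordinates drop out of `proj₁ v`: those in `J₁` vanish and those in `J₂` are
    -- killed by the projection. Hence the quadratic term involves free variables only.
    have h3 : (∀ j ∈ J₁, y (Sum.inl j) = 0) →
        A.proj₁ v = ∑ i : {i // i ∉ J}, y i.1 • A.proj₁ (W.basis i.1) := by
      intro h
      have hvsum : A.proj₁ v = ∑ i, y i • A.proj₁ (W.basis i) := by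
        simp only [hv, GradedBasis.coords, map_sum, map_smul]
      rw [hvsum, ← Fintype.sum_subtype_add_sum_subtype (fun i => i ∈ J)]
      rw [add_eq_right]
      refine Finset.sum_eq_zero ?_
      rintro ⟨i | i, hi⟩ _
      · rw [h i (Finset.inl_mem_disjSum.1 hi), zero_smul]
      · rw [A.proj₁_of_mem_V₂ (W.mem_V₂ i), smul_zero]
    have h4 : (∀ j ∈ J₁, y (Sum.inl j) = 0) → ∀ j (hj : Sum.inr j ∈ J),
        eval (fun i => y i.1) (Q ⟨Sum.inr j, hj⟩) = -inner ℝ (W.basis (Sum.inr j)) (s t) := by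
      intro h j hj
      rw [ht, h3 h]
      simp only [Q, Sum.elim_inr, map_sum, map_mul, eval_C, eval_X, map_smul, sum_apply, smul_apply,
        inner_sum, inner_smul_right, c, Finset.smul_sum, ← Finset.sum_neg_distrib]
      rw [Finset.sum_comm]
      refine Finset.sum_congr rfl fun i _ => Finset.sum_congr rfl fun i' _ => ?_
      ring
    change Λ (A.proj₁ v) = 0 ∧ Λ (A.proj₂ v) + t ∈ E ↔ _
    rw [h1, h2]
    constructor
    · rintro ⟨g1, g2⟩ ⟨j | j, hj⟩
      · simpa [Q] using g1 j (Finset.inl_mem_disjSum.1 hj)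
      · rw [h4 g1 j hj]
        exact g2 j (Finset.inr_mem_disjSum.1 hj)
    · intro g
      have g1 : ∀ j ∈ J₁, y (Sum.inl j) = 0 := fun j hj => by
        simpa [Q] using g ⟨Sum.inl j, Finset.inl_mem_disjSum.2 hj⟩
      refine ⟨g1, fun j hj => ?_⟩
      rw [← h4 g1 j (Finset.inr_mem_disjSum.2 hj)]
      exact g ⟨Sum.inr j, Finset.inr_mem_disjSum.2 hj⟩
  ext z
  constructor
  · intro hz
    obtain ⟨y, rfl⟩ := W.coords_surjective z
    exact ⟨y, (key y).1 hz, rfl⟩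
  · rintro ⟨y, hy, rfl⟩
    exact (key y).2 hy

/-- A polynomial graph that is invariant under dilations is a homogeneous algebraic variety. -/
theorem IsHomogeneousPolynomialGraph.isHomogeneousAlgebraicVariety [FiniteDimensional ℝ 𝔤] {p : ℕ}
    {T : Set A.StratifiedGroup} (h : IsHomogeneousPolynomialGraph p T)
    (hT : ∀ r : ℝ, 0 < r → dilation r '' T ⊆ T) : IsHomogeneousAlgebraicVariety T := by
  classical
  refine ⟨?_, hT⟩
  obtain ⟨W, J, Q, -, -, rfl⟩ := h
  have hcard : Fintype.card (CoordIndex A) = Module.finrank ℝ 𝔤 :=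
    (Module.finrank_eq_card_basis W.basis.toBasis).symm
  let e : CoordIndex A ≃ Fin (Module.finrank ℝ 𝔤) := Fintype.equivFinOfCardEq hcard
  have hpos : 1 ≤ Module.finrank ℝ 𝔤 := by
    obtain ⟨v, -, hv⟩ := Submodule.exists_mem_ne_zero_of_ne_bot A.V₂_ne_bot
    have : Nontrivial 𝔤 := ⟨v, 0, hv⟩
    exact Module.finrank_pos
  let b := W.basis.toBasis.reindex e
  -- One equation per coordinate, trivial for the free ones: the number of equations is then
  -- positive even if `J` is empty.
  let q : Fin (Module.finrank ℝ 𝔤) → MvPolynomial (Fin (Module.finrank ℝ 𝔤)) ℝ := fun n =>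
    if hn : e.symm n ∈ J then
      MvPolynomial.X n - MvPolynomial.rename (fun i => e i.1) (Q ⟨e.symm n, hn⟩) else 0
  refine ⟨_, hpos, fun z n => MvPolynomial.eval (fun i => b.repr z.log i) (q n),
    ⟨b, q, fun v j => rfl⟩, ?_⟩
  ext z
  obtain ⟨y, rfl⟩ := W.coords_surjective z
  have hrepr : ∀ i, b.repr (W.coords y).log i = y (e.symm i) := fun i => by
    rw [← W.inner_basis_log_coords y, ← W.basis.repr_apply_apply]
    simp [b]
  have hinj : Function.Injective W.coords := fun y y' hyy => by
    funext i
    rw [← W.inner_basis_log_coords y, hyy, W.inner_basis_log_coords]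
  rw [hinj.mem_set_image]
  simp only [mem_ofPred_eq, funext_iff, hrepr, Pi.zero_apply]
  rw [← e.forall_congr_right]
  constructor
  · intro hy i
    by_cases hi : i ∈ J
    · have := hy ⟨i, hi⟩
      simp [q, hi, MvPolynomial.eval_rename, Function.comp_def, this]
    · simp [q, hi]
  · rintro hy ⟨i, hi⟩
    have := hy i
    simpa [q, hi, MvPolynomial.eval_rename, Function.comp_def, sub_eq_zero] using this

end StratifiedGroup
end TwoStepStratifiedAlgebra

/-! ### The blow-up theorem -/

theorem theorem1p4 {𝔤 : Type*} [NormedAddCommGroup 𝔤] [InnerProductSpace ℝ 𝔤]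
    [FiniteDimensional ℝ 𝔤] (A : TwoStepStratifiedAlgebra 𝔤)
    (p : ℕ) (S : Set A.StratifiedGroup)
    (hS : TwoStepStratifiedAlgebra.StratifiedGroup.IsC2Submanifold p S)
    (x : A.StratifiedGroup) (hx : x ∈ S) :
    ∃ T : Set A.StratifiedGroup,
      TwoStepStratifiedAlgebra.StratifiedGroup.IsHomogeneousAlgebraicVariety T ∧
      TwoStepStratifiedAlgebra.StratifiedGroup.IsHomogeneousPolynomialGraph p T ∧
      ∀ ρ : TwoStepStratifiedAlgebra.StratifiedGroup.HomogeneousDistance A,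
        ρ.LocallyConvergesTo
          (TwoStepStratifiedAlgebra.StratifiedGroup.rescale S x) T := by
  obtain ⟨k, hk, g, hg, hg0, hL, hSg⟩ := hS.exists_local_equation hx
  have hgraph := TwoStepStratifiedAlgebra.StratifiedGroup.isHomogeneousPolynomialGraph_blowUp
    (A := A) (p := p) (by rw [finrank_euclideanSpace_fin]; exact hk) hL
    (fderiv ℝ (fderiv ℝ g) 0)
  exact ⟨_, hgraph.isHomogeneousAlgebraicVariety fun r _ =>
    TwoStepStratifiedAlgebra.StratifiedGroup.dilation_image_blowUp_subset _ _ r, hgraph,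
    fun ρ => ρ.locallyConvergesTo_blowUp hg hg0 hL hSg⟩
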